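/- Let $q \in [1,2)$ and let $a, b > -2$ be real numbers with $\frac{2+b}{q} = 1 + a$ and $1 \le a < 2$. Then there is a constant $C > 0$, depending only on $a, b, q$, such that for every $u \in C_c^\infty(\mathbb{R}^2, \mathbb{R}^2)$, $$\left(\int_{\mathbb{R}^2} |x|^{b}\, |u(x)|^q \, dx\right)^{1/q} \le C \int_{\mathbb{R}^2} |x|^a\, |\mathrm{D}_{\mathrm{sym}} u(x)| \, dx,$$ where $\mathrm{D}_{\mathrm{sym}} u = \frac12\left(Du + (Du)^T\right)$ is the symmetrized gradient, $|x|$ and $|u(x)|$ are Euclidean norms, and $|\mathrm{D}_{\mathrm{sym}} u(x)|$ is the Frobenius norm of the matrix. -/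

import Mathlib

open MeasureTheory
open scoped ContDiff
-- `‖M‖` is the Frobenius (Euclidean) norm of a matrix `M`.
open scoped Matrix.Norms.Frobenius

namespace KornHardy

noncomputable section

/-- The plane with its Euclidean norm and Lebesgue measure. -/
abbrev Plane : Type := EuclideanSpace ℝ (Fin 2)

/-- The Jacobian matrix `Du(x)`, with entries `(Du)_{ij} = ∂_j u_i`. -/
def jacobian (u : Plane → Plane) (x : Plane) : Matrix (Fin 2) (Fin 2) ℝ :=
  Matrix.of fun i j => (fderiv ℝ u x (EuclideanSpace.single j 1)) i

/-- The symmetrized gradient `(Du + (Du)ᵀ) / 2`. -/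
def Dsym (u : Plane → Plane) (x : Plane) : Matrix (Fin 2) (Fin 2) ℝ :=
  (1 / 2 : ℝ) • (jacobian u x + (jacobian u x).transpose)

end

end KornHardy

namespace KornHardy

open Real Set

/-! Along a line with unit direction `e`, the derivative of `u · e` is `e · Du e`, which sees only
the symmetric part of `Du`. Integrating from `x` to infinity bounds `|u(x) · e|` by a line integral
of `|Dsym u|`. Choosing the sign of `e` with `x · e ≥ 0` keeps the ray outside the ball of radius
`|x|`. Averaging over orthonormal frames turns this into a Riesz-type bound over `|y| ≥ |x|`
(`enorm_le_lintegral_exteriorKernel`).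

Jensen for the measure `|y|^a |Dsym u| dy`, then Tonelli, reduce the theorem to a bound, uniform in
`y`, on a weighted kernel integral in `x` (`lintegral_weighted_exteriorKernel_rpow_le`). There `|x|
≤ |y|` and `b ≥ 0` replace `|x|^b` by `|y|^b`, `q < 2` makes `|x - y|^(-q)` locally integrable, and
the relation between `a`, `b`, `q` cancels all powers of `|y|`. -/

/-! ### Polar coordinates and rotations -/

/-- The unit vector of the plane with polar angle `θ`. -/
noncomputable def polarUnit (θ : ℝ) : Plane := !₂[cos θ, sin θ]

lemma norm_polarUnit (θ : ℝ) : ‖polarUnit θ‖ = 1 := by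
  simp [polarUnit, EuclideanSpace.norm_eq]

@[fun_prop]
lemma continuous_polarUnit : Continuous polarUnit := by
  unfold polarUnit
  fun_prop

lemma lintegral_eq_polar {f : Plane → ENNReal} (hf : Measurable f) :
    ∫⁻ z, f z =
      ∫⁻ θ in Ioo (-π) π, ∫⁻ r in Ioi (0 : ℝ), ENNReal.ofReal r * f (r • polarUnit θ) := by
  have h : MeasurePreserving (fun p : ℝ × ℝ => (!₂[p.1, p.2] : Plane)) :=
    (PiLp.volume_preserving_toLp (Fin 2)).comp (volume_preserving_finTwoArrow ℝ).symm
  rw [← h.lintegral_comp hf, ← lintegral_comp_polarCoord_symm, polarCoord_target,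
    Measure.volume_eq_prod, ← Measure.prod_restrict, lintegral_prod_symm]
  · have h2 : ∀ r θ : ℝ, (!₂[r * cos θ, r * sin θ] : Plane) = r • polarUnit θ := by
      intro r θ; ext i; fin_cases i <;> simp [polarUnit]
    simp [h2]
  · apply Measurable.aemeasurable
    have := continuous_polarCoord_symm.measurable
    have := h.measurable
    simp only [smul_eq_mul]
    fun_prop

/-- The rotation of the plane by a right angle. -/
noncomputable def quarterTurn : Plane ≃ₗᵢ[ℝ] Plane :=
  (LinearIsometryEquiv.piLpCongrLeft 2 ℝ ℝ (Equiv.swap 0 1)).trans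
    (LinearIsometryEquiv.piLpCongrRight 2
      ![LinearIsometryEquiv.neg ℝ, LinearIsometryEquiv.refl ℝ ℝ])

lemma quarterTurn_apply (z : Plane) : quarterTurn z = !₂[-z 1, z 0] := by
  ext i
  fin_cases i <;> simp [quarterTurn, LinearIsometryEquiv.piLpCongrLeft]

/-! ### The symmetrized gradient along lines -/

/-- Cauchy–Schwarz against `e ⊗ e`, whose Frobenius norm is 1. -/
lemma abs_quadraticForm_le_frobenius (A : Matrix (Fin 2) (Fin 2) ℝ) (e : Plane) (he : ‖e‖ = 1) :
    |∑ i, ∑ j, e i * A i j * e j| ≤ ‖A‖ := by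
  have he2 : e 0 ^ 2 + e 1 ^ 2 = 1 := by
    have := EuclideanSpace.norm_sq_eq e
    simpa [he] using this.symm
  rw [Matrix.frobenius_norm_def, ← Real.sqrt_eq_rpow]
  apply Real.abs_le_sqrt
  have := Finset.sum_mul_sq_le_sq_mul_sq (Finset.univ : Finset (Fin 2 × Fin 2))
    (fun p => A p.1 p.2) (fun p => e p.1 * e p.2)
  simp only [Fintype.sum_prod_type, Fin.sum_univ_two] at this
  simp only [Fin.sum_univ_two, Real.norm_eq_abs, Real.rpow_two, sq_abs]
  have h1 : (e 0 * e 0) ^ 2 + (e 0 * e 1) ^ 2 + ((e 1 * e 0) ^ 2 + (e 1 * e 1) ^ 2) = 1 := by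
    linear_combination (e 0 ^ 2 + e 1 ^ 2 + 1) * he2
  rw [h1, mul_one] at this
  refine le_of_eq_of_le ?_ this
  ring

/-- The antisymmetric part of `Du` drops out of the quadratic form. -/
lemma inner_fderiv_self (u : Plane → Plane) (x e : Plane) :
    inner ℝ (fderiv ℝ u x e) e = ∑ i, ∑ j, e i * Dsym u x i j * e j := by
  have h : e = e 0 • EuclideanSpace.single 0 1 + e 1 • EuclideanSpace.single 1 1 := by
    ext i; fin_cases i <;> simp
  have h2 : fderiv ℝ u x e = e 0 • fderiv ℝ u x (EuclideanSpace.single 0 1) +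
      e 1 • fderiv ℝ u x (EuclideanSpace.single 1 1) := by
    conv_lhs => rw [h]
    simp
  rw [h2]
  simp [PiLp.inner_apply, Fin.sum_univ_two, Dsym, jacobian]
  ring

/-- Fundamental theorem of calculus on the ray; compact support removes the term at infinity. -/
lemma enorm_inner_le_lintegral_ray {u : Plane → Plane} (hu : ContDiff ℝ 1 u)
    (hs : HasCompactSupport u) (x e : Plane) (he : ‖e‖ = 1) :
    ‖inner ℝ (u x) e‖ₑ ≤ ∫⁻ r in Ioi (0 : ℝ), ‖Dsym u (x + r • e)‖ₑ := by
  have hemb : Topology.IsClosedEmbedding (fun t : ℝ => x + t • e) := by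
    refine Isometry.isClosedEmbedding (Isometry.of_dist_eq fun s t => ?_)
    simp [dist_eq_norm, ← sub_smul, norm_smul, he]
  set φ : ℝ → ℝ := fun t => inner ℝ (u (x + t • e)) e with hφ
  have hφd : ∀ t, HasDerivAt φ (inner ℝ (fderiv ℝ u (x + t • e) e) e) t := by
    intro t
    have h1 : HasDerivAt (fun t : ℝ => x + t • e) e t := by
      simpa using ((hasDerivAt_id t).smul_const e).const_add x
    have h2 := ((hu.differentiable one_ne_zero) (x + t • e)).hasFDerivAt.comp_hasDerivAt t h1
    simpa using h2.inner ℝ (hasDerivAt_const t e)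
  have hφc : ContDiff ℝ 1 φ := 
    (hu.comp (by fun_prop : ContDiff ℝ 1 fun t : ℝ => x + t • e)).inner ℝ contDiff_const
  have hφs : HasCompactSupport φ := by
    refine (hs.comp_isClosedEmbedding hemb).mono fun t ht => ?_
    simp only [Function.mem_support, hφ, Function.comp] at ht ⊢
    intro h0
    simp [h0] at ht
  have h0 := hφs.integral_Ioi_deriv_eq hφc 0
  have h1 : ‖inner ℝ (u x) e‖ₑ = ‖∫ t in Ioi (0 : ℝ), deriv φ t‖ₑ := by
    rw [h0]; simp [hφ]
  rw [h1]
  refine (enorm_integral_le_lintegral_enorm _).trans (lintegral_mono fun t => ?_)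
  rw [(hφd t).deriv, inner_fderiv_self, enorm_le_iff_norm_le, Real.norm_eq_abs]
  exact abs_quadraticForm_le_frobenius _ _ he

/-! ### Pointwise potential estimate -/

/-- The Riesz-type kernel `1 / |y - x|` restricted to the points `y` not closer to the origin
than `x`. -/
noncomputable def exteriorKernel (x y : Plane) : ENNReal :=
  {p : Plane × Plane | ‖p.1‖ ≤ ‖p.2‖}.indicator (fun p => ENNReal.ofReal ‖p.2 - p.1‖⁻¹) (x, y)

lemma measurable_exteriorKernel :
    Measurable (Function.uncurry exteriorKernel) := by
  refine Measurable.indicator (by fun_prop) ?_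
  exact (isClosed_le (by fun_prop) (by fun_prop)).measurableSet

lemma continuous_norm_Dsym {u : Plane → Plane} (hu : ContDiff ℝ 1 u) :
    Continuous fun x => ‖Dsym u x‖ := by
  have := hu.continuous_fderiv one_ne_zero
  simp only [Matrix.frobenius_norm_def, Dsym, jacobian, Matrix.smul_apply, Matrix.add_apply,
    Matrix.transpose_apply, Matrix.of_apply, Real.rpow_two, ← Real.sqrt_eq_rpow]
  fun_prop

lemma measurable_enorm_Dsym {u : Plane → Plane} (hu : ContDiff ℝ 1 u) :
    Measurable fun x => ‖Dsym u x‖ₑ := by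
  simp only [← ofReal_norm]
  exact (continuous_norm_Dsym hu).measurable.ennreal_ofReal

/-- The sign condition makes `|x + r e| ≥ |x|`. The polar Jacobian `r` cancels the kernel `1 / r`,
which prepares the integration over directions. -/
lemma enorm_inner_le_lintegral_exteriorKernel_ray {u : Plane → Plane} (hu : ContDiff ℝ 1 u)
    (hs : HasCompactSupport u) (x e : Plane) (he : ‖e‖ = 1) (hxe : 0 ≤ inner ℝ x e) :
    ‖inner ℝ (u x) e‖ₑ ≤ ∫⁻ r in Ioi (0 : ℝ),
      ENNReal.ofReal r * (exteriorKernel x (x + r • e) * ‖Dsym u (x + r • e)‖ₑ) := by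
  refine (enorm_inner_le_lintegral_ray hu hs x e he).trans (le_of_eq ?_)
  refine setLIntegral_congr_fun measurableSet_Ioi fun r hr => ?_
  have hr : 0 < r := hr
  have hle : ‖x‖ ≤ ‖x + r • e‖ := by
    rw [← sq_le_sq₀ (norm_nonneg _) (norm_nonneg _), norm_add_sq_real, inner_smul_right]
    have := mul_nonneg hr.le hxe
    linarith [sq_nonneg ‖r • e‖]
  rw [exteriorKernel, indicator_of_mem (by exact hle), ← mul_assoc,
    ← ENNReal.ofReal_mul hr.le]
  simp [norm_smul, he, abs_of_pos hr, hr.ne']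

/-- One of `e`, `-e` satisfies the sign condition; adding both rays removes the case distinction. -/
lemma enorm_inner_le_lintegral_exteriorKernel_line {u : Plane → Plane} (hu : ContDiff ℝ 1 u)
    (hs : HasCompactSupport u) (x e : Plane) (he : ‖e‖ = 1) :
    ‖inner ℝ (u x) e‖ₑ ≤ (∫⁻ r in Ioi (0 : ℝ),
        ENNReal.ofReal r * (exteriorKernel x (x + r • e) * ‖Dsym u (x + r • e)‖ₑ)) +
      ∫⁻ r in Ioi (0 : ℝ),
        ENNReal.ofReal r * (exteriorKernel x (x + r • -e) * ‖Dsym u (x + r • -e)‖ₑ) := by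
  rcases le_total 0 (inner ℝ x e) with h | h
  · exact (enorm_inner_le_lintegral_exteriorKernel_ray hu hs x e he h).trans le_self_add
  · have := enorm_inner_le_lintegral_exteriorKernel_ray hu hs x (-e) (by simpa using he)
      (by simpa using h)
    rw [inner_neg_right, enorm_neg] at this
    exact this.trans le_add_self

lemma enorm_le_enorm_inner_add_enorm_inner_quarterTurn (v e : Plane) (he : ‖e‖ = 1) :
    ‖v‖ₑ ≤ ‖inner ℝ v e‖ₑ + ‖inner ℝ v (quarterTurn e)‖ₑ := by
  have he2 : e 0 ^ 2 + e 1 ^ 2 = 1 := by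
    have := EuclideanSpace.norm_sq_eq e
    simpa [he] using this.symm
  have h : ‖v‖ ≤ |inner ℝ v e| + |inner ℝ v (quarterTurn e)| := by
    rw [← sq_le_sq₀ (norm_nonneg _) (by positivity)]
    have : ‖v‖ ^ 2 = inner ℝ v e ^ 2 + inner ℝ v (quarterTurn e) ^ 2 := by
      rw [EuclideanSpace.norm_sq_eq, quarterTurn_apply]
      simp [PiLp.inner_apply]
      linear_combination -(v 0 ^ 2 + v 1 ^ 2) * he2
    rw [this, add_sq, sq_abs, sq_abs]
    have : 0 ≤ 2 * |inner ℝ v e| * |inner ℝ v (quarterTurn e)| := by positivity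
    linarith
  rw [← ofReal_norm v, ← ofReal_norm, ← ofReal_norm (inner ℝ v (quarterTurn e)),
    ← ENNReal.ofReal_add (norm_nonneg _) (norm_nonneg _)]
  exact ENNReal.ofReal_le_ofReal h

/-- Pointwise control of a compactly supported field by its symmetrized gradient. -/
lemma enorm_le_lintegral_exteriorKernel {u : Plane → Plane} (hu : ContDiff ℝ 1 u)
    (hs : HasCompactSupport u) (x : Plane) :
    ‖u x‖ₑ ≤ ENNReal.ofReal (2 / π) * ∫⁻ y, exteriorKernel x y * ‖Dsym u y‖ₑ := by
  set H : Plane → ENNReal := fun z => exteriorKernel x (x + z) * ‖Dsym u (x + z)‖ₑ with hH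
  have hHm : Measurable H := by
    have h1 : Measurable (exteriorKernel x) := measurable_exteriorKernel.of_uncurry_left
    exact (h1.mul (measurable_enorm_Dsym hu)).comp (measurable_const_add x)
  have hI : ∫⁻ y, exteriorKernel x y * ‖Dsym u y‖ₑ = ∫⁻ z, H z :=
    (lintegral_add_left_eq_self _ x).symm
  have hrot : ∀ R : Plane ≃ₗᵢ[ℝ] Plane, ∫⁻ z, H z =
      ∫⁻ θ in Ioo (-π) π, ∫⁻ r in Ioi (0 : ℝ), ENNReal.ofReal r * H (r • R (polarUnit θ)) := by
    intro R
    rw [← R.measurePreserving.lintegral_comp hHm, lintegral_eq_polar (by fun_prop)]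
    simp
  have hmeas : ∀ R : Plane ≃ₗᵢ[ℝ] Plane, Measurable fun θ => ∫⁻ r in Ioi (0 : ℝ),
      ENNReal.ofReal r * H (r • R (polarUnit θ)) := by
    intro R
    refine Measurable.lintegral_prod_right' (f := fun p : ℝ × ℝ =>
      ENNReal.ofReal p.2 * H (p.2 • R (polarUnit p.1))) ?_
    have := continuous_polarUnit.measurable
    fun_prop
  -- Each of the four rays `±e`, `±quarterTurn e` contributes the full integral of `H` after
  -- integration in `θ`, by rotation invariance. Division by the angle `2π` gives `4 / (2π) = 2 /
  -- π`.
  have hsum : ∫⁻ θ in Ioo (-π) π, ‖u x‖ₑ ≤ 4 * ∫⁻ z, H z := by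
    have h4 : 4 * ∫⁻ z, H z = ((∫⁻ z, H z) + ∫⁻ z, H z) + ((∫⁻ z, H z) + ∫⁻ z, H z) := by ring
    rw [h4]
    nth_rw 1 [hrot (.refl ℝ _), hrot (.neg ℝ), hrot quarterTurn,
      hrot (quarterTurn.trans (.neg ℝ))]
    rw [← lintegral_add_left (hmeas _), ← lintegral_add_left (hmeas _), ← lintegral_add_left]
    · refine lintegral_mono fun θ => ?_
      have hn := norm_polarUnit θ
      refine (enorm_le_enorm_inner_add_enorm_inner_quarterTurn (u x) _ hn).trans ?_
      exact add_le_add (enorm_inner_le_lintegral_exteriorKernel_line hu hs x _ hn)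
        (enorm_inner_le_lintegral_exteriorKernel_line hu hs x _
          (by rw [LinearIsometryEquiv.norm_map, hn]))
    · exact (hmeas _).add (hmeas _)
  rw [setLIntegral_const, Real.volume_Ioo] at hsum
  rw [hI]
  have hpi : ENNReal.ofReal (2 / π) = 4 * (ENNReal.ofReal (π - -π))⁻¹ := by
    rw [← ENNReal.ofReal_inv_of_pos (by linarith [pi_pos]),
      show (4 : ENNReal) = ENNReal.ofReal 4 by simp, ← ENNReal.ofReal_mul (by norm_num)]
    congr 1
    field_simp
    norm_num
  rw [hpi, mul_right_comm, ← div_eq_mul_inv]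
  rw [ENNReal.le_div_iff_mul_le (.inl (by simp [pi_pos])) (.inl ENNReal.ofReal_ne_top)]
  exact hsum

/-! ### Uniform bound for the weighted kernel -/

lemma lintegral_closedBall_norm_rpow_neg {q R : ℝ} (hq : q < 2) (hR : 0 ≤ R) :
    ∫⁻ z : Plane, (Metric.closedBall 0 R).indicator (fun z => ENNReal.ofReal (‖z‖ ^ (-q))) z =
      ENNReal.ofReal (2 * π * (R ^ (2 - q) / (2 - q))) := by
  have hinner : ∀ θ : ℝ, ∫⁻ r in Ioi (0 : ℝ), ENNReal.ofReal r *
      (Metric.closedBall (0 : Plane) R).indicator (fun z => ENNReal.ofReal (‖z‖ ^ (-q)))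
        (r • polarUnit θ) = ENNReal.ofReal (R ^ (2 - q) / (2 - q)) := by
    intro θ
    have h1 : ∀ r ∈ Ioi (0 : ℝ), ENNReal.ofReal r *
        (Metric.closedBall (0 : Plane) R).indicator (fun z => ENNReal.ofReal (‖z‖ ^ (-q)))
          (r • polarUnit θ) = (Iic R).indicator (fun r => ENNReal.ofReal (r ^ (1 - q))) r := by
      intro r hr
      have hr : 0 < r := hr
      have hn : ‖r • polarUnit θ‖ = r := by
        rw [norm_smul, norm_polarUnit, mul_one, Real.norm_eq_abs, abs_of_pos hr]
      by_cases h : r ≤ R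
      · rw [indicator_of_mem (by simpa [hn] using h), indicator_of_mem (by exact h), hn,
          ← ENNReal.ofReal_mul hr.le, sub_eq_add_neg 1 q, rpow_add hr, rpow_one]
      · rw [indicator_of_notMem (by simpa [hn] using h), indicator_of_notMem (by exact h),
          mul_zero]
    have hint : IntervalIntegrable (fun r : ℝ => r ^ (1 - q)) volume 0 R :=
      intervalIntegral.intervalIntegrable_rpow' (by linarith)
    rw [setLIntegral_congr_fun measurableSet_Ioi h1, lintegral_indicator measurableSet_Iic,
      Measure.restrict_restrict measurableSet_Iic, inter_comm, Ioi_inter_Iic,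
      ← ofReal_integral_eq_lintegral_ofReal, ← intervalIntegral.integral_of_le hR,
      integral_rpow (.inl (by linarith))]
    · rw [show 1 - q + 1 = 2 - q by ring, zero_rpow (by linarith), sub_zero]
    · exact (intervalIntegrable_iff_integrableOn_Ioc_of_le hR).1 hint
    · filter_upwards [ae_restrict_mem measurableSet_Ioc] with r hr
      exact rpow_nonneg hr.1.le _
  rw [lintegral_eq_polar]
  · simp_rw [hinner]
    rw [setLIntegral_const, Real.volume_Ioo, ← ENNReal.ofReal_mul
      (div_nonneg (rpow_nonneg hR _) (by linarith))]
    congr 1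
    ring
  · exact Measurable.indicator (by fun_prop) measurableSet_closedBall

/-- On `|x| ≤ |y|` the point `x` lies within `2|y|` of `y`, and `|x|^b |y|^(-aq) ≤ |y|^(q-2)`. The
integral of `|x - y|^(-q)` over that ball scales as `|y|^(2-q)`, so the powers cancel. -/
lemma lintegral_weighted_exteriorKernel_rpow_le {q a b : ℝ} (hq0 : 0 < q) (hq : q < 2)
    (hb : 0 ≤ b) (hab : 2 + b = q * (1 + a)) {y : Plane} (hy : y ≠ 0) :
    ∫⁻ x : Plane, ENNReal.ofReal (‖x‖ ^ b) *
        (exteriorKernel x y * ENNReal.ofReal (‖y‖ ^ (-a))) ^ q ≤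
      ENNReal.ofReal (2 * π * (2 ^ (2 - q) / (2 - q))) := by
  have hy0 : 0 < ‖y‖ := norm_pos_iff.2 hy
  set g : Plane → ENNReal :=
    (Metric.closedBall 0 (2 * ‖y‖)).indicator (fun z => ENNReal.ofReal (‖z‖ ^ (-q))) with hg
  have hgm : Measurable g := Measurable.indicator (by fun_prop) measurableSet_closedBall
  have hle : ∀ x : Plane, ENNReal.ofReal (‖x‖ ^ b) *
      (exteriorKernel x y * ENNReal.ofReal (‖y‖ ^ (-a))) ^ q ≤
        ENNReal.ofReal (‖y‖ ^ (q - 2)) * g (x - y) := by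
    intro x
    by_cases h : ‖x‖ ≤ ‖y‖
    · have hmem : x - y ∈ Metric.closedBall (0 : Plane) (2 * ‖y‖) := by
        rw [mem_closedBall_zero_iff]
        linarith [norm_sub_le x y]
      rw [hg, indicator_of_mem hmem, exteriorKernel, indicator_of_mem (by exact h),
        ← ENNReal.ofReal_mul (by positivity), ENNReal.ofReal_rpow_of_nonneg (by positivity) hq0.le,
        ← ENNReal.ofReal_mul (by positivity), ← ENNReal.ofReal_mul (by positivity)]
      apply ENNReal.ofReal_le_ofReal
      rw [mul_rpow (by positivity) (by positivity), ← rpow_mul hy0.le, norm_sub_rev y x,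
        inv_rpow (norm_nonneg _), ← rpow_neg (norm_nonneg _)]
      calc ‖x‖ ^ b * (‖x - y‖ ^ (-q) * ‖y‖ ^ (-a * q))
          ≤ ‖y‖ ^ b * (‖x - y‖ ^ (-q) * ‖y‖ ^ (-a * q)) := by gcongr
        _ = (‖y‖ ^ b * ‖y‖ ^ (-a * q)) * ‖x - y‖ ^ (-q) := by ring
        _ = ‖y‖ ^ (q - 2) * ‖x - y‖ ^ (-q) := by
          rw [← rpow_add hy0]
          congr 2
          linarith
    · rw [exteriorKernel, indicator_of_notMem (by exact h), zero_mul, ENNReal.zero_rpow_of_pos hq0,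
        mul_zero]
      exact zero_le
  refine (lintegral_mono hle).trans (le_of_eq ?_)
  rw [lintegral_const_mul _ (by fun_prop),
    lintegral_sub_right_eq_self g y, lintegral_closedBall_norm_rpow_neg hq (by positivity),
    ← ENNReal.ofReal_mul (by positivity)]
  congr 1
  rw [mul_rpow (by norm_num) hy0.le]
  have : ‖y‖ ^ (q - 2) * ‖y‖ ^ (2 - q) = 1 := by rw [← rpow_add hy0]; simp
  linear_combination (2 * π * (2 ^ (2 - q) / (2 - q))) * this

/-! ### Jensen and Tonelli -/

/-- Jensen's inequality for an unnormalized measure. -/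
lemma rpow_lintegral_le_measure_univ_mul {α : Type*} [MeasurableSpace α] (ν : Measure α) {q : ℝ}
    (hq : 1 ≤ q) {f : α → ENNReal} (hf : Measurable f) :
    (∫⁻ y, f y ∂ν) ^ q ≤ ν univ ^ (q - 1) * ∫⁻ y, f y ^ q ∂ν := by
  have hq0 : 0 < q := by linarith
  have h := eLpNorm'_le_eLpNorm'_mul_rpow_measure_univ (μ := ν) one_pos hq
    hf.aestronglyMeasurable
  simp only [eLpNorm'_eq_lintegral_enorm, enorm_eq_self, ENNReal.rpow_one, div_one] at h
  refine (ENNReal.rpow_le_rpow h hq0.le).trans (le_of_eq ?_)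
  rw [ENNReal.mul_rpow_of_nonneg _ _ hq0.le, ← ENNReal.rpow_mul, ← ENNReal.rpow_mul,
    one_div_mul_cancel hq0.ne', ENNReal.rpow_one, mul_comm]
  congr 2
  field_simp

lemma lintegral_weighted_rpow_le {q a b : ℝ} (hq1 : 1 ≤ q) (hq2 : q < 2) (hb : 0 ≤ b)
    (hab : 2 + b = q * (1 + a)) {u : Plane → Plane} (hu : ContDiff ℝ 1 u)
    (hs : HasCompactSupport u) :
    ∫⁻ x, ENNReal.ofReal (‖x‖ ^ b) * ‖u x‖ₑ ^ q ≤
      ENNReal.ofReal (2 / π) ^ q * ENNReal.ofReal (2 * π * (2 ^ (2 - q) / (2 - q))) *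
        (∫⁻ y, ENNReal.ofReal (‖y‖ ^ a) * ‖Dsym u y‖ₑ) ^ q := by
  have hq0 : 0 < q := by linarith
  set w : Plane → ENNReal := fun y => ENNReal.ofReal (‖y‖ ^ a) * ‖Dsym u y‖ₑ with hw
  have hwm : Measurable w := by
    have := measurable_enorm_Dsym hu
    fun_prop
  set M := ∫⁻ y, w y with hM
  set ν : Measure Plane := volume.withDensity w with hν
  have hνu : ν univ = M := by simp [hν, hM]
  -- The factor `|y|^(-a)` compensates the weight carried by `ν`.
  set K : Plane → Plane → ENNReal :=
    fun x y => exteriorKernel x y * ENNReal.ofReal (‖y‖ ^ (-a)) with hK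
  have hKm : Measurable (Function.uncurry K) :=
    measurable_exteriorKernel.mul (by fun_prop)
  -- The weights `|y|^a` and `|y|^(-a)` need not be reciprocal at the origin, a null set.
  have hne : ∀ᵐ y : Plane, y ≠ 0 := by simp [ae_iff]
  have hν_int : ∀ f : Plane → ENNReal, Measurable f → ∫⁻ y, f y ∂ν = ∫⁻ y, w y * f y :=
    fun f hf => lintegral_withDensity_eq_lintegral_mul _ hwm hf
  have hpt : ∀ x, ‖u x‖ₑ ^ q ≤
      ENNReal.ofReal (2 / π) ^ q * (M ^ (q - 1) * ∫⁻ y, w y * K x y ^ q) := by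
    intro x
    have hKx : Measurable (K x) := hKm.of_uncurry_left
    have h1 : ∫⁻ y, exteriorKernel x y * ‖Dsym u y‖ₑ = ∫⁻ y, K x y ∂ν := by
      rw [hν_int _ hKx]
      refine lintegral_congr_ae ?_
      filter_upwards [hne] with y hy
      have hy0 : 0 < ‖y‖ := norm_pos_iff.2 hy
      have h2 : ENNReal.ofReal (‖y‖ ^ a) * ENNReal.ofReal (‖y‖ ^ (-a)) = 1 := by
        rw [← ENNReal.ofReal_mul (by positivity), ← rpow_add hy0]
        simp
      simp only [hw, hK]
      calc exteriorKernel x y * ‖Dsym u y‖ₑ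
          = exteriorKernel x y * ‖Dsym u y‖ₑ * 1 := (mul_one _).symm
        _ = _ := by rw [← h2]; ring
    have h3 := ENNReal.rpow_le_rpow (enorm_le_lintegral_exteriorKernel hu hs x) hq0.le
    rw [h1, ENNReal.mul_rpow_of_nonneg _ _ hq0.le] at h3
    refine h3.trans ?_
    gcongr
    rw [← hνu, ← hν_int _ (hKx.pow_const q)]
    exact rpow_lintegral_le_measure_univ_mul ν hq1 hKx
  have hGm : Measurable fun p : Plane × Plane => w p.2 * K p.1 p.2 ^ q :=
    (hwm.comp measurable_snd).mul (hKm.pow_const q)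
  have hswap : ∫⁻ x : Plane, ENNReal.ofReal (‖x‖ ^ b) * ∫⁻ y, w y * K x y ^ q =
      ∫⁻ y, w y * ∫⁻ x : Plane, ENNReal.ofReal (‖x‖ ^ b) * K x y ^ q := by
    have e1 : ∀ x : Plane, ENNReal.ofReal (‖x‖ ^ b) * ∫⁻ y, w y * K x y ^ q =
        ∫⁻ y, ENNReal.ofReal (‖x‖ ^ b) * (w y * K x y ^ q) := fun x =>
      (lintegral_const_mul _ (hGm.comp measurable_prodMk_left)).symm
    have e2 : ∀ y : Plane, w y * ∫⁻ x : Plane, ENNReal.ofReal (‖x‖ ^ b) * K x y ^ q =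
        ∫⁻ x : Plane, ENNReal.ofReal (‖x‖ ^ b) * (w y * K x y ^ q) := fun y => by
      have : Measurable fun x => K x y := hKm.of_uncurry_right
      rw [← lintegral_const_mul _ (by fun_prop)]
      simp only [mul_left_comm]
    simp_rw [e1, e2]
    refine lintegral_lintegral_swap (Measurable.aemeasurable ?_)
    exact (by fun_prop : Measurable fun p : Plane × Plane => ENNReal.ofReal (‖p.1‖ ^ b)).mul hGm
  have hM_pow : M ^ (q - 1) * M = M ^ q := by
    conv_lhs => rw [← ENNReal.rpow_one M, ← ENNReal.rpow_mul, one_mul,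
      ← ENNReal.rpow_add_of_nonneg _ _ (by linarith) zero_le_one, sub_add_cancel]
  set D := ENNReal.ofReal (2 * π * (2 ^ (2 - q) / (2 - q)))
  have hinner : Measurable fun x => ∫⁻ y, w y * K x y ^ q := hGm.lintegral_prod_right'
  calc ∫⁻ x, ENNReal.ofReal (‖x‖ ^ b) * ‖u x‖ₑ ^ q
      ≤ ∫⁻ x : Plane, (ENNReal.ofReal (2 / π) ^ q * M ^ (q - 1)) *
          (ENNReal.ofReal (‖x‖ ^ b) * ∫⁻ y, w y * K x y ^ q) := by
        refine lintegral_mono fun x => (mul_le_mul_right (hpt x) _).trans (le_of_eq ?_)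
        ring
    _ = (ENNReal.ofReal (2 / π) ^ q * M ^ (q - 1)) *
          ∫⁻ y, w y * ∫⁻ x : Plane, ENNReal.ofReal (‖x‖ ^ b) * K x y ^ q := by
        rw [lintegral_const_mul _ (by fun_prop), hswap]
    _ ≤ (ENNReal.ofReal (2 / π) ^ q * M ^ (q - 1)) * ∫⁻ y, w y * D := by
        refine mul_le_mul_right (lintegral_mono_ae ?_) _
        filter_upwards [hne] with y hy
        gcongr
        exact lintegral_weighted_exteriorKernel_rpow_le hq0 hq2 hb hab hy
    _ = ENNReal.ofReal (2 / π) ^ q * D * M ^ q := by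
        rw [lintegral_mul_const _ hwm, ← hM_pow]
        ring

/-! ### Return to real-valued integrals -/

lemma integrable_rpow_mul_norm_Dsym {a : ℝ} (ha : 0 ≤ a) {u : Plane → Plane}
    (hu : ContDiff ℝ 1 u) (hs : HasCompactSupport u) :
    Integrable fun x : Plane => ‖x‖ ^ a * ‖Dsym u x‖ := by
  refine Continuous.integrable_of_hasCompactSupport ?_ ?_
  · exact (continuous_norm.rpow_const fun _ => .inr ha).mul (continuous_norm_Dsym hu)
  · refine (hs.fderiv ℝ).mono fun x hx h0 => hx ?_
    have : jacobian u x = 0 := by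
      ext i j
      simp [jacobian, h0]
    simp [Dsym, this]

end KornHardy

theorem theorem1 (q a b : ℝ) (hq1 : 1 ≤ q) (hq2 : q < 2) (ha : -2 < a) (hb : -2 < b)
    (hab : (2 + b) / q = 1 + a) (ha1 : 1 ≤ a) (ha2 : a < 2) :
    ∃ C : ℝ, 0 < C ∧ ∀ u : KornHardy.Plane → KornHardy.Plane,
      ContDiff ℝ ∞ u → HasCompactSupport u →
        (∫ x : KornHardy.Plane, ‖x‖ ^ b * ‖u x‖ ^ q) ^ (1 / q) ≤
          C * ∫ x : KornHardy.Plane, ‖x‖ ^ a * ‖KornHardy.Dsym u x‖ := by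
  have hq0 : 0 < q := by linarith
  have hab' : 2 + b = q * (1 + a) := by
    rw [div_eq_iff hq0.ne'] at hab
    linarith
  -- From `a, q ≥ 1`: `2 + b = q (1 + a) ≥ 2`.
  have hb0 : 0 ≤ b := by nlinarith
  set D : ℝ := 2 * Real.pi * (2 ^ (2 - q) / (2 - q)) with hD
  have hD0 : 0 < D := by
    have : 0 < 2 - q := by linarith
    positivity
  have hpi := Real.pi_pos
  -- The `q`-th root of `(2 / π)^q * D`: potential estimate times kernel bound.
  refine ⟨2 / Real.pi * D ^ (1 / q), by positivity, fun u hu hs => ?_⟩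
  have hu1 : ContDiff ℝ 1 u := hu.of_le (by exact_mod_cast le_top)
  have hR0 : 0 ≤ ∫ x : KornHardy.Plane, ‖x‖ ^ a * ‖KornHardy.Dsym u x‖ :=
    integral_nonneg fun x => by positivity
  set R := ∫ x : KornHardy.Plane, ‖x‖ ^ a * ‖KornHardy.Dsym u x‖ with hR
  have hRl : ∫⁻ x : KornHardy.Plane, ENNReal.ofReal (‖x‖ ^ a) * ‖KornHardy.Dsym u x‖ₑ =
      ENNReal.ofReal R := by
    rw [hR, ofReal_integral_eq_lintegral_ofReal
      (KornHardy.integrable_rpow_mul_norm_Dsym (by linarith) hu1 hs)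
      (.of_forall fun x => by positivity)]
    refine lintegral_congr fun x => ?_
    rw [ENNReal.ofReal_mul (by positivity), ofReal_norm]
  have hmain := KornHardy.lintegral_weighted_rpow_le hq1 hq2 hb0 hab' hu1 hs
  rw [hRl, ENNReal.ofReal_rpow_of_nonneg (by positivity) hq0.le,
    ENNReal.ofReal_rpow_of_nonneg hR0 hq0.le, ← ENNReal.ofReal_mul (by positivity),
    ← ENNReal.ofReal_mul (by positivity), ← hD] at hmain
  have hL : ∫ x : KornHardy.Plane, ‖x‖ ^ b * ‖u x‖ ^ q ≤ (2 / Real.pi) ^ q * D * R ^ q := by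
    have hmeas : AEStronglyMeasurable fun x : KornHardy.Plane => ‖x‖ ^ b * ‖u x‖ ^ q := by
      have := hu1.continuous.measurable
      exact Measurable.aestronglyMeasurable (by fun_prop)
    rw [integral_eq_lintegral_of_nonneg_ae (.of_forall fun x => by positivity) hmeas]
    refine ENNReal.toReal_le_of_le_ofReal (by positivity) (le_of_eq_of_le ?_ hmain)
    refine lintegral_congr fun x => ?_
    rw [ENNReal.ofReal_mul (by positivity), ← ENNReal.ofReal_rpow_of_nonneg (norm_nonneg _) hq0.le,
      ofReal_norm]
  calc (∫ x : KornHardy.Plane, ‖x‖ ^ b * ‖u x‖ ^ q) ^ (1 / q)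
      ≤ ((2 / Real.pi) ^ q * D * R ^ q) ^ (1 / q) :=
        Real.rpow_le_rpow (integral_nonneg fun x => by positivity) hL (by positivity)
    _ = 2 / Real.pi * D ^ (1 / q) * R := by
        rw [Real.mul_rpow (by positivity) (by positivity),
          Real.mul_rpow (by positivity) (by positivity), one_div,
          Real.rpow_rpow_inv (by positivity) hq0.ne', Real.rpow_rpow_inv hR0 hq0.ne']
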